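/- **Dyck paths and Tamari intervals.** A Dyck path of size $n$ is a word with $n$ letters $u$ and $n$ letters $d$, each prefix of which has at least as many $u$'s as $d$'s; $\bullet$ is the empty one, and letters are read as steps $u=(1,1)$, $d=(1,-1)$. A contact is a point of the path on the $x$-axis. A right rotation turns a Dyck path $A\,d\,P_1\,B$ into $A\,P_1\,d\,B$, where $P_1$ is a non-empty Dyck path that meets the axis only at its two ends; $P\preceq Q$ means that $Q$ is obtained from $P$ by finitely many (possibly zero) right rotations. A Tamari interval of size $n$ is a pair $I=[P,Q]$ of Dyck paths of size $n$ with $P\preceq Q$. Its contact vector is $(c_0(I),\dots,c_n(I))$, where $c_0(I)$ is the number of non-initial contacts of $P$ and, for $i\ge 1$, $c_i(I)$ is the number of non-initial contacts of the (longest) Dyck path that directly follows the $i$-th up step of $P$. Its descent vector is $(d_0(I),\dots,d_n(I))$, where $Q=d^{\,d_n(I)}u\,d^{\,d_{n-1}(I)}u\cdots u\,d^{\,d_0(I)}$. For $1\le i\le c_0(I_1)+1$, the pointed interval $I_1^{\bullet i}$ is $I_1=[P_1,Q_1]$ with the $i$-th contact of $P_1$, counted from right to left, distinguished; it splits $P_1=P_1^{\ell}P_1^{r}$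 into two Dyck paths. For an interval $I_2=[P_2,Q_2]$ put $$\oplus_{\mathcal I}(I_1^{\bullet i},I_2)=[\,u P_1^{\ell} d P_1^{r}P_2,\; uQ_1dQ_2\,].$$ **Extended fighting fish.** Fighting fish are the words obtained from $ENWS$ by repeatedly replacing a subword $W$ by $NWS$, or $N$ by $ENW$, or $WN$ by $NW$. Extended fighting fish are the words obtained from fighting fish by replacing some (possibly no) occurrences of $WN$ by $V$, together with the empty fish $\varepsilon=EVS$. The jaw length $\mathrm{jaw}(F)$ of an extended fighting fish $F\neq\varepsilon$ is its number of initial letters $E$, and $\mathrm{jaw}(\varepsilon)=0$. Every $F\ne\varepsilon$ can be written $F=E^{\mathrm{jaw}(F)}NG$. For $1\le i\le \mathrm{jaw}(F)+1$ the $i$-augmentation is $$\maltese_i(F)=E^iNE^{\mathrm{jaw}(F)-i}NGS\ \text{ if } i\le \mathrm{jaw}(F),\qquad \maltese_{\mathrm{jaw}(F)+1}(F)=E^{\mathrm{jaw}(F)+1}NVGS,$$ and $\maltese_1(\varepsilon)=ENWS$. For $F_1=G_1S$ and $F_2=E^{\mathrm{jaw}(F_2)}NG_2$, both different from $\varepsilon$,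 let $F_1\odot F_2=E^{\mathrm{jaw}(F_2)}G_1G_2$; moreover $F\odot\varepsilon=\varepsilon\odot F=F$. Put $\oplus_{\mathcal F}(F_1^{\bullet i},F_2)=\maltese_i(F_1)\odot F_2$ for $1\le i\le\mathrm{jaw}(F_1)+1$. **Theorem.** There is exactly one map $\Phi$ from Tamari intervals to extended fighting fish such that $\Phi([\bullet,\bullet])=\varepsilon$ and, for all Tamari intervals $I_1,I_2$ and all $1\le i\le c_0(I_1)+1$, one has $i\le \mathrm{jaw}(\Phi(I_1))+1$ and $\Phi(\oplus_{\mathcal I}(I_1^{\bullet i},I_2))=\oplus_{\mathcal F}(\Phi(I_1)^{\bullet i},\Phi(I_2))$. Let $I=[P,Q]$ be a Tamari interval of size $n\ge 0$. For each $0\le i\le n$, $c_i(I)=0$ or $d_{n-i}(I)=0$. Put $$w_i=\begin{cases}E^{c_i(I)-1}N&\text{if } c_i(I)\ge 1 \text{ and } d_{n-i}(I)=0,\\ WS^{d_{n-i}(I)-1}&\text{if } c_i(I)=0\text{ and } d_{n-i}(I)\ge 1,\\ V&\text{if } c_i(I)=d_{n-i}(I)=0.\end{cases}$$ Then $\Phi(I)$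 is the word $E\,w_0w_1\cdots w_n\,S$; in particular this word is an extended fighting fish. -/

import Mathlib

/-! ### Words and extended fighting fish -/

/-- The letters `E, N, W, S` (free left lower, right lower, right upper, left upper edges) and
`V` (a triangle). -/
inductive FishStep
  | E : FishStep
  | N : FishStep
  | W : FishStep
  | S : FishStep
  | V : FishStep
  deriving DecidableEq

open FishStep in
/-- Words of fighting fish: the words obtained from `ENWS` by upper, lower and double gluings. -/
inductive IsFightingFish : List FishStep → Prop
  | head : IsFightingFish [E, N, W, S]
  | upperGluing (a b : List FishStep) :
      IsFightingFish (a ++ [W] ++ b) → IsFightingFish (a ++ [N, W, S] ++ b)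
  | lowerGluing (a b : List FishStep) :
      IsFightingFish (a ++ [N] ++ b) → IsFightingFish (a ++ [E, N, W] ++ b)
  | doubleGluing (a b : List FishStep) :
      IsFightingFish (a ++ [W, N] ++ b) → IsFightingFish (a ++ [N, W] ++ b)

open FishStep in
/-- `ReplacesBranchPoints G F`: the word `F` is obtained from `G` by replacing the subword `WN` by
`V` at some (possibly none, possibly all) of its occurrences. -/
inductive ReplacesBranchPoints : List FishStep → List FishStep → Prop
  | nil : ReplacesBranchPoints [] []
  | keep (x : FishStep) {G F : List FishStep} :
      ReplacesBranchPoints G F → ReplacesBranchPoints (x :: G) (x :: F)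
  | fill {G F : List FishStep} :
      ReplacesBranchPoints G F → ReplacesBranchPoints (W :: N :: G) (V :: F)

/-- The word `EVS` of the empty fish. -/
def emptyFishWord : List FishStep := [FishStep.E, FishStep.V, FishStep.S]

/-- Extended fighting fish, as words; the empty fish is included. -/
def IsExtendedFightingFish (F : List FishStep) : Prop :=
  F = emptyFishWord ∨ ∃ G, IsFightingFish G ∧ ReplacesBranchPoints G F

/-- The type of all extended fighting fish, including the empty fish. -/
structure ExtendedFightingFish where
  word : List FishStep
  isFish : IsExtendedFightingFish word

/-- The empty fish. -/
def ExtendedFightingFish.empty : ExtendedFightingFish := ⟨emptyFishWord, Or.inl rfl⟩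

/-- The jaw length: the number of initial letters `E`, except for the empty fish, which has jaw
length `0` by convention. -/
def jaw (F : List FishStep) : ℕ :=
  if F = emptyFishWord then 0 else (F.takeWhile (· = FishStep.E)).length

open FishStep in
/-- Concatenation `F₁ ⊙ F₂`: if `F₁ = G₁ S` and `F₂ = E^j N G₂` with `j = jaw F₂`, it is
`E^j G₁ G₂`; the empty fish is neutral. -/
def fishConcat (F₁ F₂ : List FishStep) : List FishStep :=
  if F₁ = emptyFishWord then F₂
  else if F₂ = emptyFishWord then F₁
  else List.replicate (jaw F₂) E ++ F₁.dropLast ++ F₂.drop (jaw F₂ + 1)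

open FishStep in
/-- The `i`-augmentation of `F = E^j N G`, where `j = jaw F` and `1 ≤ i ≤ j + 1`: it is
`E^i N E^(j-i) N G S` if `i ≤ j` and `E^(j+1) N V G S` if `i = j + 1`; the `1`-augmentation of the
empty fish is `ENWS`. -/
def fishAugment (i : ℕ) (F : List FishStep) : List FishStep :=
  if F = emptyFishWord then [E, N, W, S]
  else if i ≤ jaw F then
    List.replicate i E ++ [N] ++ List.replicate (jaw F - i) E ++ [N] ++ F.drop (jaw F + 1) ++ [S]
  else List.replicate (jaw F + 1) E ++ [N, V] ++ F.drop (jaw F + 1) ++ [S]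

/-- The low composition of the fish `F₁`, pointed at `i`, with the fish `F₂`. -/
def lowComposition (i : ℕ) (F₁ F₂ : List FishStep) : List FishStep :=
  fishConcat (fishAugment i F₁) F₂

/-! ### Dyck paths and the Tamari order

A Dyck path is Mathlib's `DyckWord`; its size is `DyckWord.semilength`, `p + q` is the
concatenation, `p.nest` is the path `u p d`, and `p.IsNested` says that `p` is non-empty and returns
to the axis only at its end. -/

open DyckStep in
/-- `P'` is obtained from `P` by a right rotation: `P = A d P₁ B` and `P' = A P₁ d B`, where `P₁`
is a non-empty Dyck path that returns to the axis only at its end. -/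
def RightRotation (P P' : DyckWord) : Prop :=
  ∃ (A B : List DyckStep) (P₁ : DyckWord), P₁.IsNested ∧
    P.toList = A ++ [D] ++ P₁.toList ++ B ∧ P'.toList = A ++ P₁.toList ++ [D] ++ B

/-- The Tamari order: `Q` is reached from `P` by finitely many (possibly zero) right rotations. -/
def TamariLE : DyckWord → DyckWord → Prop := Relation.ReflTransGen RightRotation

/-- What remains of a word after its `i`-th up step (the whole word if `i = 0`). -/
def afterUp : ℕ → List DyckStep → List DyckStep
  | 0, w => w
  | _ + 1, [] => []
  | i + 1, DyckStep.U :: w => afterUp i w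
  | i + 1, DyckStep.D :: w => afterUp (i + 1) w

/-- The walk `w` is read starting at height `h`, until it ends or goes below height `0`; the value
is the number of down steps it makes from height `1` to height `0`. In particular,
`returnCount 0 w` is the number of non-initial contacts of the longest Dyck path that is a prefix
of `w`. -/
def returnCount : ℕ → List DyckStep → ℕ
  | _, [] => 0
  | h, DyckStep.U :: w => returnCount (h + 1) w
  | 0, DyckStep.D :: _ => 0
  | 1, DyckStep.D :: w => returnCount 0 w + 1
  | h + 2, DyckStep.D :: w => returnCount (h + 1) w

/-- The component `c_i(P)` of the contact vector, for `0 ≤ i ≤ n` with `n` the size of `P`: the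
number of non-initial contacts of `P` if `i = 0`, and of the Dyck path following the `i`-th up step
of `P` if `i ≥ 1`. -/
def contactVector (P : DyckWord) (i : ℕ) : ℕ := returnCount 0 (afterUp i P.toList)

/-- The component `d_k(P)` of the descent vector, for `0 ≤ k ≤ n` with `n` the size of `P`, where
`P = d^{d_n(P)} u d^{d_{n-1}(P)} u ... u d^{d_0(P)}`: so `d_k(P)` is the length of the run of down
steps directly after the `(n-k)`-th up step. -/
def descentVector (P : DyckWord) (k : ℕ) : ℕ :=
  ((afterUp (P.semilength - k) P.toList).takeWhile (· = DyckStep.D)).length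

/-! ### Context lemmas for the Tamari order -/

theorem RightRotation.add_left {P P' : DyckWord} (R : DyckWord) (h : RightRotation P P') :
    RightRotation (R + P) (R + P') := by
  obtain ⟨A, B, P₁, h₁, h₂, h₃⟩ := h
  refine ⟨R.toList ++ A, B, P₁, h₁, ?_, ?_⟩
  · change R.toList ++ P.toList = _
    simp [h₂]
  · change R.toList ++ P'.toList = _
    simp [h₃]

theorem RightRotation.add_right {P P' : DyckWord} (R : DyckWord) (h : RightRotation P P') :
    RightRotation (P + R) (P' + R) := by
  obtain ⟨A, B, P₁, h₁, h₂, h₃⟩ := h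
  refine ⟨A, B ++ R.toList, P₁, h₁, ?_, ?_⟩
  · change P.toList ++ R.toList = _
    simp [h₂]
  · change P'.toList ++ R.toList = _
    simp [h₃]

theorem RightRotation.nest {P P' : DyckWord} (h : RightRotation P P') :
    RightRotation P.nest P'.nest := by
  obtain ⟨A, B, P₁, h₁, h₂, h₃⟩ := h
  refine ⟨[DyckStep.U] ++ A, B ++ [DyckStep.D], P₁, h₁, ?_, ?_⟩
  · simp [DyckWord.nest, h₂]
  · simp [DyckWord.nest, h₃]

theorem TamariLE.add {P P' Q Q' : DyckWord} (h : TamariLE P P') (k : TamariLE Q Q') :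
    TamariLE (P + Q) (P' + Q') :=
  (Relation.ReflTransGen.lift (· + Q) (fun _ _ r => RightRotation.add_right Q r) _ _ h).trans
    (Relation.ReflTransGen.lift (P' + ·) (fun _ _ r => RightRotation.add_left P' r) _ _ k)

theorem TamariLE.nest {P P' : DyckWord} (h : TamariLE P P') : TamariLE P.nest P'.nest :=
  Relation.ReflTransGen.lift DyckWord.nest (fun _ _ r => RightRotation.nest r) _ _ h

/-- A right rotation turns `(u L d)(u R d) S` into `(u L u R d d) S`. -/
theorem RightRotation.nest_add (L R S : DyckWord) :
    RightRotation (L.nest + (R.nest + S)) ((L + R.nest).nest + S) := by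
  refine ⟨[DyckStep.U] ++ L.toList, S.toList, R.nest, DyckWord.IsNested.nest, ?_, ?_⟩
  · change L.nest.toList ++ (R.nest.toList ++ S.toList) = _
    simp [DyckWord.nest]
  · change (L + R.nest).nest.toList ++ S.toList = _
    change ([DyckStep.U] ++ (L.toList ++ R.nest.toList) ++ [DyckStep.D]) ++ S.toList = _
    simp

theorem TamariLE.nest_add (L R : DyckWord) : TamariLE (L.nest + R) (L + R).nest := by
  induction hn : R.semilength using Nat.strong_induction_on generalizing L R with
  | _ n ih =>
    by_cases hR : R = 0
    · subst hR
      simp only [add_zero]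
      exact Relation.ReflTransGen.refl
    · have hdec := DyckWord.nest_insidePart_add_outsidePart hR
      have hlt := DyckWord.semilength_outsidePart_lt hR
      have key := ih _ (hn ▸ hlt) (L + R.insidePart.nest) R.outsidePart rfl
      have rot := RightRotation.nest_add L R.insidePart R.outsidePart
      rw [hdec] at rot
      rw [add_assoc, hdec] at key
      exact Relation.ReflTransGen.head rot key

/-- Paths that are comparable in the Tamari order have the same size. -/
theorem TamariLE.semilength_eq {P Q : DyckWord} (h : TamariLE P Q) :
    P.semilength = Q.semilength := by
  induction h with
  | refl => rfl
  | tail _ r ih =>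
    obtain ⟨A, B, P₁, -, h₂, h₃⟩ := r
    rw [ih, DyckWord.semilength, DyckWord.semilength, h₂, h₃]
    simp

/-! ### Tamari intervals -/

/-- A Tamari interval `[P, Q]`. -/
structure TamariInterval where
  lower : DyckWord
  upper : DyckWord
  le : TamariLE lower upper

namespace TamariInterval

/-- The size of an interval `[P, Q]`: the common size of `P` and `Q`. -/
def size (I : TamariInterval) : ℕ := I.lower.semilength

/-- The interval of size `0`. -/
def empty : TamariInterval := ⟨0, 0, Relation.ReflTransGen.refl⟩

/-- The contact vector of `[P, Q]` is that of `P`. -/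
def contact (I : TamariInterval) (i : ℕ) : ℕ := contactVector I.lower i

/-- The descent vector of `[P, Q]` is that of `Q`. -/
def descent (I : TamariInterval) (k : ℕ) : ℕ := descentVector I.upper k

/-- Concatenation `I₁ ⊙ I₂ = [P₁ P₂, Q₁ Q₂]`. -/
def concat (I₁ I₂ : TamariInterval) : TamariInterval :=
  ⟨I₁.lower + I₂.lower, I₁.upper + I₂.upper, I₁.le.add I₂.le⟩

end TamariInterval

/-- A pointed Tamari interval `[Pˡ · Pʳ, Q]`: an interval whose lower path `P = Pˡ Pʳ` is split at a
distinguished contact. -/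
structure PointedTamariInterval where
  left : DyckWord
  right : DyckWord
  upper : DyckWord
  le : TamariLE (left + right) upper

namespace PointedTamariInterval

/-- The underlying interval. -/
def toInterval (J : PointedTamariInterval) : TamariInterval := ⟨J.left + J.right, J.upper, J.le⟩

/-- The number `i` such that the distinguished contact is the `i`-th one from right to left. -/
def index (J : PointedTamariInterval) : ℕ := contactVector J.right 0 + 1

/-- The augmentation `[u Pˡ d Pʳ, u Q d]` of a pointed interval. -/
def augment (J : PointedTamariInterval) : TamariInterval :=
  ⟨J.left.nest + J.right, J.upper.nest, (TamariLE.nest_add J.left J.right).trans J.le.nest⟩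

/-- The left composition of a pointed interval with an interval. -/
def leftComposition (J : PointedTamariInterval) (I₂ : TamariInterval) : TamariInterval :=
  J.augment.concat I₂

end PointedTamariInterval

/-! ### The map `Φ` and the explicit word -/

/-- The recursive definition of `Φ`: `Φ` sends the empty interval to the empty fish; and, if `J` is
the interval `I₁` pointed at `i`, then `Φ(I₁)` can be pointed at `i` (that is,
`i ≤ jaw (Φ(I₁)) + 1`), and `Φ` sends the left composition of `J` and `I₂` to the low composition of
`Φ(I₁)`, pointed at `i`, and `Φ(I₂)`. -/
def SatisfiesPhiRecursion (Φ : TamariInterval → ExtendedFightingFish) : Prop :=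
  Φ TamariInterval.empty = ExtendedFightingFish.empty ∧
  ∀ (J : PointedTamariInterval) (I₂ : TamariInterval),
    J.index ≤ jaw (Φ J.toInterval).word + 1 ∧
    (Φ (J.leftComposition I₂)).word =
      lowComposition J.index (Φ J.toInterval).word (Φ I₂).word

open FishStep in
/-- The word `w_i`: `E^(c_i - 1) N` if `c_i ≥ 1`, `W S^(d_{n-i} - 1)` if `d_{n-i} ≥ 1`, and `V` if
both are zero. -/
def blockWord (I : TamariInterval) (i : ℕ) : List FishStep :=
  if 1 ≤ I.contact i then List.replicate (I.contact i - 1) E ++ [N]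
  else if 1 ≤ I.descent (I.size - i) then
    [W] ++ List.replicate (I.descent (I.size - i) - 1) S
  else [V]

/-- The word `E w_0 w_1 ... w_n S`. -/
def explicitWord (I : TamariInterval) : List FishStep :=
  [FishStep.E] ++ (List.range (I.size + 1)).flatMap (blockWord I) ++ [FishStep.S]

/-!
The explicit word `I ↦ E w₀ w₁ ⋯ w_n S` itself satisfies the recursion that defines `Φ`, and every
interval is reached from the empty one by left compositions; hence `Φ` exists, is unique, and is
given by the explicit word.

Every interval is reached (`TamariInterval.composition_induction`): the pairs of paths generated by
left compositions form a relation `TamariDecomp`, which contains the diagonal and is closed under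
prepending a right rotation to the lower path (`TamariDecomp.head`). The closure is a short case
analysis once rotations are described along first-return decompositions (`RotStep`): a rotation that
produces `u Pˡ d Pʳ P₂` takes place inside `Pˡ`, `Pʳ` or `P₂`, or moves the distinguished down step,
in which case its source is again of this form, with the distinguished contact further left.

The explicit word satisfies the recursion (`PointedTamariInterval.explicitWord_leftComposition`):
list the contacts of the lower path and the runs of down steps of the upper path, one entry for each
up step. Both lists are additive under concatenation. Augmentation of a nonempty interval puts
`c₀(Pˡ)` and `0` in front and lengthens the last run of down steps, whose contact is `0`, by one;
this is exactly the effect of the `i`-augmentation on the blocks of the word. The same computation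
shows inductively that a contact or the matching descent always vanishes.

The word is an extended fighting fish (`IsExtendedFightingFish.lowComposition`): concatenation
replaces a single letter `N` of the second fish by the first fish without its final `S`, which is
allowed because replacing `N` by `ENW` is a lower gluing and the gluings that build the first fish
never use its final `S`. That augmentations of fish are fish is proved for all positions at once, by
induction on the gluings (`IsFightingFish.exists_shape_augment`).
-/

/-! ### Dyck words and single rotations -/

theorem List.IsPrefix.of_append {α : Type*} {v a b : List α} (h : v <+: a ++ b) :
    v <+: a ∨ ∃ w, v = a ++ w ∧ w <+: b := by
  obtain ⟨t, ht⟩ := h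
  rcases List.append_eq_append_iff.mp ht with ⟨w, hw, -⟩ | ⟨w, hw, hb⟩
  · exact Or.inl ⟨w, hw.symm⟩
  · exact Or.inr ⟨w, hw, ⟨t, hb.symm⟩⟩

namespace DyckWord

theorem toList_add (p q : DyckWord) : (p + q).toList = p.toList ++ q.toList := rfl

theorem toList_zero : (0 : DyckWord).toList = [] := rfl

theorem toList_nest (p : DyckWord) :
    p.nest.toList = DyckStep.U :: (p.toList ++ [DyckStep.D]) := rfl

/-- Induction along the first-return decomposition `p = u q d r`. -/
theorem nest_add_induction {motive : DyckWord → Prop} (zero : motive 0)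
    (nest_add : ∀ q r, motive q → motive r → motive (q.nest + r)) (p : DyckWord) : motive p := by
  induction hn : p.semilength using Nat.strong_induction_on generalizing p with
  | _ n ih =>
    by_cases hp : p = 0
    · exact hp ▸ zero
    · rw [← nest_insidePart_add_outsidePart hp]
      exact nest_add _ _ (ih _ (hn ▸ semilength_insidePart_lt hp) _ rfl)
        (ih _ (hn ▸ semilength_outsidePart_lt hp) _ rfl)

theorem nest_add_inj {p q p' q' : DyckWord} :
    p.nest + q = p'.nest + q' ↔ p = p' ∧ q = q' := by
  refine ⟨fun h => ⟨?_, ?_⟩, fun h => by rw [h.1, h.2]⟩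
  · simpa using congrArg insidePart h
  · simpa using congrArg outsidePart h

theorem nest_add_ne_zero (p q : DyckWord) : p.nest + q ≠ 0 := by
  simp

theorem count_D_le_count_U_of_prefix (p : DyckWord) {w : List DyckStep} (h : w <+: p.toList) :
    w.count DyckStep.D ≤ w.count DyckStep.U := by
  rw [List.prefix_iff_eq_take.mp h]
  exact p.count_D_le_count_U _

theorem count_U_le_count_D_of_suffix (p : DyckWord) {w : List DyckStep} (h : w <:+ p.toList) :
    w.count DyckStep.U ≤ w.count DyckStep.D := by
  obtain ⟨v, hv⟩ := h
  have h₁ := p.count_D_le_count_U_of_prefix ⟨w, hv⟩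
  have h₂ := p.count_U_eq_count_D
  rw [← hv, List.count_append, List.count_append] at h₂
  omega

theorem exists_toList_eq (w : List DyckStep) (h : w.count DyckStep.U = w.count DyckStep.D)
    (h' : ∀ v, v <+: w → v.count DyckStep.D ≤ v.count DyckStep.U) :
    ∃ p : DyckWord, p.toList = w :=
  ⟨⟨w, h, fun i => h' _ (List.take_prefix i w)⟩, rfl⟩

/-- What follows a Dyck prefix of a Dyck word is a Dyck word. -/
theorem exists_add_eq (p q : DyckWord) {w : List DyckStep} (h : p.toList = q.toList ++ w) :
    ∃ r : DyckWord, r.toList = w ∧ p = q + r := by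
  have hq : p.toList.take q.toList.length = q.toList := by simp [h]
  have hr : (p.drop q.toList.length (by rw [hq]; exact q.count_U_eq_count_D)).toList = w := by
    simp [drop, h]
  exact ⟨_, hr, DyckWord.ext (by rw [toList_add, hr, h])⟩

end DyckWord

/-- Right rotations, described along the first-return decomposition `u X d S` of the rotated path:
the moved down step is the one that matches the initial `u`, or lies inside `X`, or inside
`S`. -/
inductive RotStep : DyckWord → DyckWord → Prop
  | root (L R S : DyckWord) : RotStep (L.nest + (R.nest + S)) ((L + R.nest).nest + S)
  | inside {X X' : DyckWord} (S : DyckWord) : RotStep X X' → RotStep (X.nest + S) (X'.nest + S)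
  | outside (X : DyckWord) {S S' : DyckWord} : RotStep S S' → RotStep (X.nest + S) (X.nest + S')

namespace RotStep

/-- Exchanging a down step of a Dyck path with a Dyck path that directly follows it yields a Dyck
path. -/
theorem exists_exchange {X : DyckWord} {A B : List DyckStep} {P₁ : DyckWord}
    (h : X.toList = A ++ DyckStep.D :: (P₁.toList ++ B)) :
    ∃ X' : DyckWord, X'.toList = A ++ P₁.toList ++ DyckStep.D :: B := by
  have hP := P₁.count_U_eq_count_D
  have hX := X.count_U_eq_count_D
  have hA := X.count_D_le_count_U_of_prefix ⟨_, h.symm⟩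
  apply DyckWord.exists_toList_eq
  · simp only [h, List.count_append, List.count_cons] at hX ⊢
    omega
  · intro v hv
    rw [List.append_assoc] at hv
    rcases hv.of_append with hv | ⟨v, rfl, hv₁⟩
    · exact X.count_D_le_count_U_of_prefix (h ▸ hv.trans (List.prefix_append _ _))
    rcases hv₁.of_append with hv | ⟨v, rfl, hv₂⟩
    · have := P₁.count_D_le_count_U_of_prefix hv
      simp only [List.count_append]
      omega
    rcases List.prefix_cons_iff.mp hv₂ with rfl | ⟨v, rfl, hv₃⟩
    · simp only [List.count_append, List.count_nil]
      omega
    · have := X.count_D_le_count_U_of_prefix (w := A ++ DyckStep.D :: (P₁.toList ++ v)) (by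
        rw [h, List.prefix_append_right_inj, List.prefix_cons_inj, List.prefix_append_right_inj]
        exact hv₃)
      simp only [List.count_append, List.count_cons] at this ⊢
      omega

theorem of_rightRotation {P P' : DyckWord} (h : RightRotation P P') : RotStep P P' := by
  obtain ⟨A, B, P₁, hn, h₁, h₂⟩ := h
  induction P using DyckWord.nest_add_induction generalizing A B P' with
  | zero => simp [DyckWord.toList_zero] at h₁
  | nest_add X Y ihX ihY =>
    have root (hX : X.toList = A.tail) (hA : A = DyckStep.U :: A.tail)
        (hY : Y.toList = P₁.toList ++ B) : RotStep (X.nest + Y) P' := by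
      obtain ⟨S, rfl, rfl⟩ := DyckWord.exists_add_eq _ _ hY
      obtain ⟨R, rfl⟩ : ∃ R : DyckWord, P₁ = R.nest := ⟨_, (P₁.nest_denest hn).symm⟩
      convert root X R S
      ext1
      rw [h₂, hA, ← hX]
      simp [DyckWord.toList_add, DyckWord.toList_nest]
    simp only [DyckWord.toList_add, DyckWord.toList_nest] at h₁
    rcases A with _ | ⟨a, A⟩
    · simp at h₁
    simp only [List.cons_append, List.cons.injEq, List.append_assoc, List.nil_append] at h₁
    obtain ⟨rfl, h₁⟩ := h₁
    rcases List.append_eq_append_iff.mp h₁ with ⟨C, hA, hC⟩ | ⟨C, hX, hC⟩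
    · rcases C with _ | ⟨c, C⟩
      · exact root (by simpa using hA.symm) rfl (by simpa using hC)
      · -- the moved down step lies in `Y`
        simp only [List.cons_append, List.cons.injEq] at hC
        obtain ⟨rfl, hC⟩ := hC
        obtain ⟨Y', hY'⟩ := exists_exchange hC
        have : P' = X.nest + Y' := by
          ext1
          simp [DyckWord.toList_add, DyckWord.toList_nest, h₂, hY', hA]
        rw [this]
        exact outside X (ihY C B (by simpa using hC) (by simpa using hY'))
    · rcases C with _ | ⟨c, C⟩
      · exact root (by simpa using hX) rfl (by simpa using hC.symm)
      · -- the moved down step lies in `X`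
        simp only [List.cons_append, List.cons.injEq] at hC
        obtain ⟨rfl, hC⟩ := hC
        have hXc := X.count_U_eq_count_D
        have hAX := X.count_D_le_count_U_of_prefix (w := A ++ [DyckStep.D]) ⟨C, by simp [hX]⟩
        have key : ∃ B', C = P₁.toList ++ B' ∧ B = B' ++ DyckStep.D :: Y.toList := by
          rcases List.append_eq_append_iff.mp hC with ⟨B', hC', hB⟩ | ⟨B', hP, hB⟩
          · exact ⟨B', hC', hB⟩
          · rcases B' with _ | ⟨b, B'⟩
            · exact ⟨[], by simpa using hP.symm, by simpa using hB.symm⟩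
            · -- `P₁` would go below its starting height at the end of `X`
              simp only [List.cons_append, List.cons.injEq] at hB
              obtain ⟨rfl, hB⟩ := hB
              have := P₁.count_D_le_count_U_of_prefix (w := C ++ [DyckStep.D])
                ⟨B', by simp [hP]⟩
              simp [hX] at hXc hAX this
              omega
        obtain ⟨B', rfl, rfl⟩ := key
        obtain ⟨X', hX'⟩ := exists_exchange hX
        have : P' = X'.nest + Y := by
          ext1
          simp [DyckWord.toList_add, DyckWord.toList_nest, h₂, hX']
        rw [this]
        exact inside Y (ihX A B' (by simpa using hX) (by simpa using hX'))

theorem add_right {X X' : DyckWord} (h : RotStep X X') (Z : DyckWord) :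
    RotStep (X + Z) (X' + Z) := by
  induction h with
  | root L R S => simpa only [add_assoc] using root L R (S + Z)
  | inside S h _ => simpa only [add_assoc] using inside (S + Z) h
  | outside X _ ih => simpa only [add_assoc] using outside X ih

theorem add_left (Z : DyckWord) {X X' : DyckWord} (h : RotStep X X') :
    RotStep (Z + X) (Z + X') := by
  induction Z using DyckWord.nest_add_induction with
  | zero => simpa only [zero_add] using h
  | nest_add q r _ ih => simpa only [add_assoc] using outside q ih

theorem of_nest_add {P X Y : DyckWord} (h : RotStep P (X.nest + Y)) :
    (∃ L R : DyckWord, X = L + R.nest ∧ P = L.nest + (R.nest + Y)) ∨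
    (∃ X₀, RotStep X₀ X ∧ P = X₀.nest + Y) ∨ (∃ Y₀, RotStep Y₀ Y ∧ P = X.nest + Y₀) := by
  generalize hP : X.nest + Y = P' at h
  cases h with
  | root L R S =>
    obtain ⟨rfl, rfl⟩ := DyckWord.nest_add_inj.mp hP
    exact Or.inl ⟨L, R, rfl, rfl⟩
  | inside S h =>
    obtain ⟨rfl, rfl⟩ := DyckWord.nest_add_inj.mp hP
    exact Or.inr (Or.inl ⟨_, h, rfl⟩)
  | outside X h =>
    obtain ⟨rfl, rfl⟩ := DyckWord.nest_add_inj.mp hP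
    exact Or.inr (Or.inr ⟨_, h, rfl⟩)

/-- A contact of the rotated path is never moved over: a rotation that produces a concatenation is
a rotation of one of the two factors. -/
theorem of_add {P X Y : DyckWord} (h : RotStep P (X + Y)) :
    (∃ X₀, RotStep X₀ X ∧ P = X₀ + Y) ∨ (∃ Y₀, RotStep Y₀ Y ∧ P = X + Y₀) := by
  induction X using DyckWord.nest_add_induction generalizing P with
  | zero => exact Or.inr ⟨P, by simpa using h, by simp⟩
  | nest_add q r _ ih =>
    rw [add_assoc] at h
    rcases h.of_nest_add with ⟨L, R, rfl, rfl⟩ | ⟨q₀, hq, rfl⟩ | ⟨Z, hZ, rfl⟩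
    · exact Or.inl ⟨_, root L R r, by simp only [add_assoc]⟩
    · exact Or.inl ⟨_, inside r hq, by simp only [add_assoc]⟩
    · rcases ih hZ with ⟨r₀, hr, rfl⟩ | ⟨Y₀, hY, rfl⟩
      · exact Or.inl ⟨_, outside q hr, by simp only [add_assoc]⟩
      · exact Or.inr ⟨_, hY, by simp only [add_assoc]⟩

end RotStep

/-! ### Recursive decomposition of Tamari intervals -/

/-- The pairs of Dyck paths that arise from the empty pair by left compositions. -/
inductive TamariDecomp : DyckWord → DyckWord → Prop
  | zero : TamariDecomp 0 0
  | comp {Pl Pr Q₁ P₂ Q₂ : DyckWord} : TamariDecomp (Pl + Pr) Q₁ → TamariDecomp P₂ Q₂ →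
      TamariDecomp (Pl.nest + Pr + P₂) (Q₁.nest + Q₂)

namespace TamariDecomp

theorem refl (P : DyckWord) : TamariDecomp P P := by
  induction P using DyckWord.nest_add_induction with
  | zero => exact zero
  | nest_add q r hq hr =>
    simpa only [add_zero] using comp (Pl := q) (Pr := 0) (by simpa only [add_zero] using hq) hr

/-- If the moved down step is the distinguished one of `u Pˡ d Pʳ P₂`, undoing the rotation only
moves the pointed contact; all other rotations take place in `Pˡ`, in `Pʳ` or in `P₂`. -/
theorem head {P P' Q : DyckWord} (h : RotStep P P') (h' : TamariDecomp P' Q) :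
    TamariDecomp P Q := by
  induction h' generalizing P with
  | zero =>
    generalize hP : (0 : DyckWord) = P' at h
    cases h <;> exact absurd hP.symm (DyckWord.nest_add_ne_zero _ _)
  | @comp Pl Pr Q₁ P₂ Q₂ h₁ h₂ ih₁ ih₂ =>
    rw [add_assoc] at h
    rcases h.of_nest_add with ⟨L, R, rfl, rfl⟩ | ⟨X, hX, rfl⟩ | ⟨Y, hY, rfl⟩
    · have := comp (Pl := L) (Pr := R.nest + Pr) (by rwa [← add_assoc]) h₂
      simpa only [add_assoc] using this
    · simpa only [add_assoc] using comp (ih₁ (hX.add_right Pr)) h₂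
    · rcases hY.of_add with ⟨Z, hZ, rfl⟩ | ⟨Z, hZ, rfl⟩
      · simpa only [add_assoc] using comp (ih₁ (hZ.add_left Pl)) h₂
      · simpa only [add_assoc] using comp h₁ (ih₂ hZ)

theorem of_tamariLE {P Q : DyckWord} (h : TamariLE P Q) : TamariDecomp P Q := by
  induction h using Relation.ReflTransGen.head_induction_on with
  | refl => exact refl Q
  | head h _ ih => exact head (RotStep.of_rightRotation h) ih

theorem tamariLE {P Q : DyckWord} (h : TamariDecomp P Q) : TamariLE P Q := by
  induction h with
  | zero => exact Relation.ReflTransGen.refl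
  | @comp Pl Pr Q₁ P₂ Q₂ _ _ ih₁ ih₂ =>
    exact TamariLE.add ((TamariLE.nest_add Pl Pr).trans ih₁.nest) ih₂

end TamariDecomp

/-- Every Tamari interval arises from the empty interval by left compositions. -/
theorem TamariInterval.composition_induction {motive : TamariInterval → Prop}
    (empty : motive TamariInterval.empty)
    (comp : ∀ (J : PointedTamariInterval) (I : TamariInterval), motive J.toInterval → motive I →
      motive (J.leftComposition I)) (I : TamariInterval) : motive I := by
  obtain ⟨P, Q, h⟩ := I
  induction TamariDecomp.of_tamariLE h with
  | zero => exact empty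
  | @comp Pl Pr Q₁ P₂ Q₂ h₁ h₂ ih₁ ih₂ =>
    exact comp ⟨Pl, Pr, Q₁, h₁.tamariLE⟩ ⟨P₂, Q₂, h₂.tamariLE⟩ (ih₁ _) (ih₂ _)

/-! ### Fighting fish under augmentation and concatenation -/

/-- The word `E^j N G`. Every nonempty fish of jaw length `j` is of this form, with `j ≥ 1`. -/
def fishShape (j : ℕ) (G : List FishStep) : List FishStep :=
  List.replicate j FishStep.E ++ FishStep.N :: G

theorem fishShape_succ (j : ℕ) (G : List FishStep) :
    fishShape (j + 1) G = FishStep.E :: fishShape j G := rfl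

theorem fishShape_ne_empty (j : ℕ) (G : List FishStep) : fishShape j G ≠ emptyFishWord := by
  rcases j with _ | _ | j <;> simp [fishShape, emptyFishWord, List.replicate_succ]

theorem takeWhile_fishShape (j : ℕ) (G : List FishStep) :
    (fishShape j G).takeWhile (· = FishStep.E) = List.replicate j FishStep.E := by
  induction j with
  | zero => simp [fishShape]
  | succ j ih => rw [fishShape_succ, List.takeWhile_cons]; simp [ih, List.replicate_succ]

theorem jaw_fishShape (j : ℕ) (G : List FishStep) : jaw (fishShape j G) = j := by
  simp [jaw, fishShape_ne_empty, takeWhile_fishShape]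

theorem drop_fishShape (j : ℕ) (G : List FishStep) : (fishShape j G).drop (j + 1) = G := by
  induction j with
  | zero => rfl
  | succ j ih => rw [fishShape_succ, List.drop_succ_cons, ih]

theorem fishConcat_fishShape (a b : ℕ) (G₁ G₂ : List FishStep) :
    fishConcat (fishShape a (G₁ ++ [FishStep.S])) (fishShape b G₂) =
      fishShape (b + a) (G₁ ++ G₂) := by
  rw [fishConcat, if_neg (fishShape_ne_empty _ _), if_neg (fishShape_ne_empty _ _), jaw_fishShape,
    drop_fishShape]
  have : fishShape a (G₁ ++ [FishStep.S]) = fishShape a G₁ ++ [FishStep.S] := by simp [fishShape]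
  rw [this, List.dropLast_concat]
  simp only [fishShape, List.replicate_add, List.append_assoc, List.cons_append]

theorem fishAugment_fishShape_of_le {i j : ℕ} (h : i ≤ j) (G : List FishStep) :
    fishAugment i (fishShape j G) = fishShape i (fishShape (j - i) (G ++ [FishStep.S])) := by
  rw [fishAugment, if_neg (fishShape_ne_empty _ _), jaw_fishShape, if_pos h, drop_fishShape]
  simp [fishShape]

theorem fishAugment_fishShape_succ (j : ℕ) (G : List FishStep) :
    fishAugment (j + 1) (fishShape j G) =
      fishShape (j + 1) (FishStep.V :: (G ++ [FishStep.S])) := by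
  rw [fishAugment, if_neg (fishShape_ne_empty _ _), jaw_fishShape, if_neg (by omega),
    drop_fishShape]
  simp [fishShape]

theorem fishConcat_empty_left (F : List FishStep) : fishConcat emptyFishWord F = F := if_pos rfl

theorem fishConcat_empty_right (F : List FishStep) : fishConcat F emptyFishWord = F := by
  by_cases h : F = emptyFishWord
  · rw [h, fishConcat_empty_left]
  · rw [fishConcat, if_neg h, if_pos rfl]

/-- In a word that starts with `E^j N`, an occurrence of a factor that begins with neither `E` nor
`N` lies after the first `N`. -/
theorem append_cons_eq_fishShape {a b G : List FishStep} {x : FishStep} {j : ℕ}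
    (hE : x ≠ FishStep.E) (hN : x ≠ FishStep.N) (h : a ++ x :: b = fishShape j G) :
    ∃ a', a = fishShape j a' ∧ G = a' ++ x :: b := by
  induction j generalizing a with
  | zero =>
    rcases a with _ | ⟨y, a⟩ <;> simp [fishShape] at h
    · exact absurd h.1 hN
    · exact ⟨a, by simp [fishShape, h.1], h.2.symm⟩
  | succ j ih =>
    rcases a with _ | ⟨y, a⟩ <;> simp [fishShape_succ] at h
    · exact absurd h.1 hE
    · obtain ⟨a', rfl, hG⟩ := ih h.2
      exact ⟨a', by rw [h.1, fishShape_succ], hG⟩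

theorem append_N_eq_fishShape {a b G : List FishStep} {j : ℕ}
    (h : a ++ FishStep.N :: b = fishShape j G) :
    (a = List.replicate j FishStep.E ∧ b = G) ∨
      ∃ a', a = fishShape j a' ∧ G = a' ++ FishStep.N :: b := by
  induction j generalizing a with
  | zero =>
    rcases a with _ | ⟨y, a⟩ <;> simp [fishShape] at h
    · exact Or.inl ⟨rfl, h⟩
    · exact Or.inr ⟨a, by simp [fishShape, h.1], h.2.symm⟩
  | succ j ih =>
    rcases a with _ | ⟨y, a⟩ <;> simp [fishShape_succ] at h
    rcases ih h.2 with ⟨rfl, rfl⟩ | ⟨a', rfl, hG⟩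
    · exact Or.inl ⟨by simp [h.1, List.replicate_succ], rfl⟩
    · exact Or.inr ⟨a', by rw [h.1, fishShape_succ], hG⟩

theorem fishShape_append (j : ℕ) (G H : List FishStep) :
    fishShape j G ++ H = fishShape j (G ++ H) := by simp [fishShape]

namespace IsFightingFish

open FishStep

theorem exists_eq_append_S {F : List FishStep} (h : IsFightingFish F) : ∃ G, F = G ++ [S] := by
  have key {a b x y G : List FishStep} (hx : S ∉ x) (h : a ++ x ++ b = G ++ [S])
      (hne : x ≠ []) : ∃ G', a ++ y ++ b = G' ++ [S] := by
    rcases b.eq_nil_or_concat' with rfl | ⟨b, z, rfl⟩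
    · rcases x.eq_nil_or_concat' with rfl | ⟨x, z, rfl⟩
      · exact absurd rfl hne
      · simp only [List.append_nil, ← List.append_assoc] at h
        have := (List.append_inj' h rfl).2
        simp_all
    · simp only [← List.append_assoc] at h
      have := (List.append_inj' h rfl).2
      exact ⟨a ++ y ++ b, by simp_all⟩
  induction h with
  | head => exact ⟨[E, N, W], rfl⟩
  | upperGluing a b _ ih => exact ih.elim fun _ h => key (by simp) h (by simp)
  | lowerGluing a b _ ih => exact ih.elim fun _ h => key (by simp) h (by simp)
  | doubleGluing a b _ ih => exact ih.elim fun _ h => key (by simp) h (by simp)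

/-- Gluing a fish `G S` into the lower right edge `N` of another fish. This follows from the
single-cell case, a lower gluing, since the final `S` of `G S` is never used by a gluing. -/
theorem glue_fish {x y F : List FishStep} (h : IsFightingFish (x ++ [N] ++ y))
    (hF : IsFightingFish F) {G : List FishStep} (hG : F = G ++ [S]) :
    IsFightingFish (x ++ G ++ y) := by
  induction hF generalizing G with
  | head =>
    obtain rfl : [E, N, W] = G := (List.append_inj' (s₁ := [E, N, W]) hG rfl).1
    exact lowerGluing x y h
  | upperGluing a b hF ih =>
    obtain ⟨G', hG'⟩ := hF.exists_eq_append_S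
    rcases b.eq_nil_or_concat' with rfl | ⟨b, z, rfl⟩
    · simp only [List.append_nil] at hG'
      have := (List.append_inj' hG' rfl).2
      simp at this
    · simp only [← List.append_assoc] at hG' hG
      obtain ⟨rfl, hz⟩ := List.append_inj' hG rfl
      have := ih (G := a ++ [W] ++ b) (by simp_all)
      simpa using upperGluing (x ++ a) (b ++ y) (by simpa using this)
  | lowerGluing a b hF ih =>
    obtain ⟨G', hG'⟩ := hF.exists_eq_append_S
    rcases b.eq_nil_or_concat' with rfl | ⟨b, z, rfl⟩
    · simp only [List.append_nil] at hG'
      have := (List.append_inj' hG' rfl).2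
      simp at this
    · simp only [← List.append_assoc] at hG' hG
      obtain ⟨rfl, hz⟩ := List.append_inj' hG rfl
      have := ih (G := a ++ [N] ++ b) (by simp_all)
      simpa using lowerGluing (x ++ a) (b ++ y) (by simpa using this)
  | doubleGluing a b hF ih =>
    obtain ⟨G', hG'⟩ := hF.exists_eq_append_S
    rcases b.eq_nil_or_concat' with rfl | ⟨b, z, rfl⟩
    · simp only [List.append_nil] at hG'
      have : a ++ [W] ++ [N] = G' ++ [S] := by simpa using hG'
      have := (List.append_inj' this rfl).2
      simp at this
    · simp only [← List.append_assoc] at hG' hG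
      obtain ⟨rfl, hz⟩ := List.append_inj' hG rfl
      have := ih (G := a ++ [W, N] ++ b) (by simp_all)
      simpa using doubleGluing (x ++ a) (b ++ y) (by simpa using this)

/-- Every fighting fish has the form `E^j N G`, and its augmentations (with the triangle of the last
one left open, as `W N`) are fighting fish. A gluing at the first `N` raises the jaw
length; the new middle augmentation then comes from the old last one by a double gluing. -/
theorem exists_shape_augment {F : List FishStep} (h : IsFightingFish F) :
    ∃ j G, 1 ≤ j ∧ F = fishShape j (G ++ [S]) ∧
      (∀ i, 1 ≤ i → i ≤ j → IsFightingFish (fishShape i (fishShape (j - i) (G ++ [S] ++ [S])))) ∧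
      IsFightingFish (fishShape (j + 1) (W :: N :: (G ++ [S] ++ [S]))) := by
  suffices H : ∃ j G, 1 ≤ j ∧ F = fishShape j G ∧
      (∀ i, 1 ≤ i → i ≤ j → IsFightingFish (fishShape i (fishShape (j - i) (G ++ [S])))) ∧
      IsFightingFish (fishShape (j + 1) (W :: N :: (G ++ [S]))) by
    obtain ⟨j, G, hj, rfl, h₁, h₂⟩ := H
    obtain ⟨F', hF⟩ := h.exists_eq_append_S
    rcases G.eq_nil_or_concat' with rfl | ⟨G, z, rfl⟩
    · have := (List.append_inj' (hF : List.replicate j E ++ [N] = _) rfl).2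
      simp at this
    · rw [← fishShape_append] at hF
      obtain ⟨-, hz⟩ := List.append_inj' hF rfl
      rw [hz] at h₁ h₂ ⊢
      exact ⟨j, G, hj, rfl, h₁, h₂⟩
  -- gluings that take place after the first `N`
  have key {j : ℕ} {a' x y b : List FishStep} (hj : 1 ≤ j)
      (glue : ∀ a b, IsFightingFish (a ++ x ++ b) → IsFightingFish (a ++ y ++ b))
      (h₁ : ∀ i, 1 ≤ i → i ≤ j →
        IsFightingFish (fishShape i (fishShape (j - i) (a' ++ x ++ b ++ [S]))))
      (h₂ : IsFightingFish (fishShape (j + 1) (W :: N :: (a' ++ x ++ b ++ [S])))) :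
      ∃ k G, 1 ≤ k ∧ fishShape j a' ++ y ++ b = fishShape k G ∧
        (∀ i, 1 ≤ i → i ≤ k → IsFightingFish (fishShape i (fishShape (k - i) (G ++ [S])))) ∧
        IsFightingFish (fishShape (k + 1) (W :: N :: (G ++ [S]))) := by
    refine ⟨j, a' ++ y ++ b, hj, by simp [fishShape], fun i hi hij => ?_, ?_⟩
    · simpa [fishShape] using glue (fishShape i (fishShape (j - i) a')) (b ++ [S])
        (by simpa [fishShape] using h₁ i hi hij)
    · simpa [fishShape] using glue (fishShape (j + 1) (W :: N :: a')) (b ++ [S])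
        (by simpa [fishShape] using h₂)
  induction h with
  | head =>
    refine ⟨1, [W, S], le_rfl, rfl, fun i hi hi' => ?_, ?_⟩
    · obtain rfl : i = 1 := le_antisymm hi' hi
      exact upperGluing [E, N] [S] head
    · exact upperGluing [E, E, N, W] [S] (lowerGluing [E] [W, S] head)
  | upperGluing a b _ ih =>
    obtain ⟨j, G, hj, hF, h₁, h₂⟩ := ih
    obtain ⟨a', rfl, rfl⟩ := append_cons_eq_fishShape (by simp) (by simp)
      (by simpa using hF : a ++ W :: b = _)
    exact key (x := [W]) hj upperGluing (by simpa using h₁) (by simpa using h₂)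
  | lowerGluing a b _ ih =>
    obtain ⟨j, G, hj, hF, h₁, h₂⟩ := ih
    rcases append_N_eq_fishShape (by simpa using hF : a ++ N :: b = _) with
      ⟨rfl, rfl⟩ | ⟨a', rfl, rfl⟩
    · have glued : IsFightingFish (fishShape (j + 2) (W :: W :: N :: (b ++ [S]))) := by
        have := lowerGluing (List.replicate (j + 1) E) (W :: N :: (b ++ [S]))
          (by simpa [fishShape] using h₂)
        simpa [fishShape, List.replicate_succ'] using this
      refine ⟨j + 1, W :: b, by omega, by simp [fishShape, List.replicate_succ'],
        fun i hi hij => ?_, ?_⟩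
      · rcases hij.lt_or_eq with hij | rfl
        · have := lowerGluing (fishShape i (List.replicate (j - i) E)) (b ++ [S])
            (by simpa [fishShape] using h₁ i hi (by omega))
          rw [Nat.succ_sub (by omega)]
          simpa [fishShape, List.replicate_succ'] using this
        · have := doubleGluing (fishShape (j + 1) []) (b ++ [S])
            (by simpa [fishShape] using h₂)
          simpa [fishShape] using this
      · have := doubleGluing (fishShape (j + 2) [W]) (b ++ [S]) (by simpa [fishShape] using glued)
        simpa [fishShape] using this
    · exact key (x := [N]) hj lowerGluing (by simpa using h₁) (by simpa using h₂)
  | doubleGluing a b _ ih =>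
    obtain ⟨j, G, hj, hF, h₁, h₂⟩ := ih
    obtain ⟨a', rfl, rfl⟩ := append_cons_eq_fishShape (by simp) (by simp)
      (by simpa using hF : a ++ W :: (N :: b) = _)
    exact key (x := [W, N]) hj doubleGluing (by simpa using h₁) (by simpa using h₂)

end IsFightingFish

namespace ReplacesBranchPoints

open FishStep

theorem refl (G : List FishStep) : ReplacesBranchPoints G G := by
  induction G with
  | nil => exact nil
  | cons x G ih => exact keep x ih

theorem append {G F G' F' : List FishStep} (h : ReplacesBranchPoints G F)
    (h' : ReplacesBranchPoints G' F') : ReplacesBranchPoints (G ++ G') (F ++ F') := by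
  induction h with
  | nil => exact h'
  | keep x _ ih => exact keep x ih
  | fill _ ih => exact fill ih

theorem fishShape (j : ℕ) {G F : List FishStep} (h : ReplacesBranchPoints G F) :
    ReplacesBranchPoints (fishShape j G) (fishShape j F) :=
  (refl _).append (keep N h)

theorem of_fishShape {j : ℕ} {G F : List FishStep}
    (h : ReplacesBranchPoints (_root_.fishShape j G) F) :
    ∃ F', F = _root_.fishShape j F' ∧ ReplacesBranchPoints G F' := by
  induction j generalizing F with
  | zero =>
    cases h with
    | keep _ h => exact ⟨_, rfl, h⟩
  | succ j ih =>
    rw [fishShape_succ] at h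
    cases h with
    | keep _ h =>
      obtain ⟨F', rfl, hF⟩ := ih h
      exact ⟨F', rfl, hF⟩

theorem of_append_S {G F : List FishStep} (h : ReplacesBranchPoints (G ++ [S]) F) :
    ∃ F', F = F' ++ [S] ∧ ReplacesBranchPoints G F' := by
  generalize hG : G ++ [S] = H at h
  induction h generalizing G with
  | nil => simp at hG
  | keep x h ih =>
    rcases G with _ | ⟨y, G⟩ <;> simp at hG
    · obtain ⟨rfl, rfl⟩ := hG
      cases h
      exact ⟨[], rfl, nil⟩
    · obtain ⟨F', rfl, hF⟩ := ih hG.2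
      exact ⟨y :: F', by simp [hG.1], keep y hF⟩
  | fill h ih =>
    rcases G with _ | ⟨y, _ | ⟨z, G⟩⟩ <;> simp at hG
    obtain ⟨F', rfl, hF⟩ := ih hG.2.2
    exact ⟨V :: F', rfl, by rw [hG.1, hG.2.1]; exact fill hF⟩

end ReplacesBranchPoints

namespace IsExtendedFightingFish

open FishStep

/-- An extended fighting fish is empty, or has the form `E^j N G S` and fills branch points of a
fighting fish `E^j N H S`. -/
theorem cases_shape {F : List FishStep} (h : IsExtendedFightingFish F) :
    F = emptyFishWord ∨ ∃ j G H, 1 ≤ j ∧ F = fishShape j (G ++ [S]) ∧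
      IsFightingFish (fishShape j (H ++ [S])) ∧ ReplacesBranchPoints H G ∧
      (∀ i, 1 ≤ i → i ≤ j → IsFightingFish (fishShape i (fishShape (j - i) (H ++ [S] ++ [S])))) ∧
      IsFightingFish (fishShape (j + 1) (W :: N :: (H ++ [S] ++ [S]))) := by
  rcases h with h | ⟨F', hF', hF⟩
  · exact Or.inl h
  · obtain ⟨j, H, hj, rfl, h₁, h₂⟩ := hF'.exists_shape_augment
    obtain ⟨K, rfl, hK⟩ := hF.of_fishShape
    obtain ⟨G, rfl, hG⟩ := hK.of_append_S
    exact Or.inr ⟨j, G, H, hj, rfl, hF', hG, h₁, h₂⟩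

theorem fishAugment {F : List FishStep} (h : IsExtendedFightingFish F) {i : ℕ} (hi : 1 ≤ i)
    (hi' : i ≤ jaw F + 1) : IsExtendedFightingFish (fishAugment i F) := by
  rcases h.cases_shape with rfl | ⟨j, G, H, hj, rfl, -, hG, h₁, h₂⟩
  · rw [_root_.fishAugment, if_pos rfl]
    exact Or.inr ⟨_, IsFightingFish.head, ReplacesBranchPoints.refl _⟩
  · have hG' := (hG.append (.refl [S])).append (.refl [S])
    rw [jaw_fishShape] at hi'
    rcases hi'.lt_or_eq with hij | rfl
    · rw [fishAugment_fishShape_of_le (by omega)]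
      exact Or.inr ⟨_, h₁ i hi (by omega), (hG'.fishShape _).fishShape _⟩
    · rw [fishAugment_fishShape_succ]
      exact Or.inr ⟨_, h₂, (ReplacesBranchPoints.fill hG').fishShape _⟩

theorem fishConcat {F₁ F₂ : List FishStep} (h₁ : IsExtendedFightingFish F₁)
    (h₂ : IsExtendedFightingFish F₂) : IsExtendedFightingFish (fishConcat F₁ F₂) := by
  rcases h₁.cases_shape with rfl | ⟨a, G₁, H₁, -, rfl, hf₁, hG₁, -⟩
  · rwa [fishConcat_empty_left]
  rcases h₂.cases_shape with rfl | ⟨b, G₂, H₂, -, rfl, hf₂, hG₂, -⟩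
  · rwa [fishConcat_empty_right]
  rw [fishConcat_fishShape]
  have := IsFightingFish.glue_fish (x := List.replicate b E) (y := H₂ ++ [S])
    (by simpa [_root_.fishShape] using hf₂) hf₁ (fishShape_append _ _ _).symm
  refine Or.inr ⟨fishShape (b + a) (H₁ ++ (H₂ ++ [S])), ?_, ?_⟩
  · simpa only [fishShape, List.replicate_add, List.append_assoc, List.cons_append] using this
  · exact (hG₁.append (hG₂.append (.refl [S]))).fishShape _

theorem lowComposition {F₁ F₂ : List FishStep} (h₁ : IsExtendedFightingFish F₁)
    (h₂ : IsExtendedFightingFish F₂) {i : ℕ} (hi : 1 ≤ i) (hi' : i ≤ jaw F₁ + 1) :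
    IsExtendedFightingFish (lowComposition i F₁ F₂) :=
  (h₁.fishAugment hi hi').fishConcat h₂

end IsExtendedFightingFish

/-! ### Contact and descent lists -/

/-- The values of a statistic `f` on what remains of the word after each of its up steps, in
order. -/
def mapAfterUps (f : List DyckStep → ℕ) : List DyckStep → List ℕ
  | [] => []
  | DyckStep.U :: w => f w :: mapAfterUps f w
  | DyckStep.D :: w => mapAfterUps f w

/-- The length of the initial run of down steps. -/
def downRun (w : List DyckStep) : ℕ := (w.takeWhile (· = DyckStep.D)).length

theorem length_mapAfterUps (f : List DyckStep → ℕ) (w : List DyckStep) :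
    (mapAfterUps f w).length = w.count DyckStep.U := by
  induction w with
  | nil => rfl
  | cons x w ih => cases x <;> simp [mapAfterUps, ih]

theorem mapAfterUps_append {f : List DyckStep → ℕ} {w v : List DyckStep}
    (h : ∀ s, DyckStep.U :: s <:+ w → f (s ++ v) = f s) :
    mapAfterUps f (w ++ v) = mapAfterUps f w ++ mapAfterUps f v := by
  induction w with
  | nil => rfl
  | cons x w ih =>
    have ih := ih fun s hs => h s (hs.trans (List.suffix_cons x w))
    cases x
    · simp [mapAfterUps, ih, h w List.suffix_rfl]
    · simpa [mapAfterUps] using ih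

theorem afterUp_zero (w : List DyckStep) : afterUp 0 w = w := by cases w <;> rfl

theorem map_range_afterUp (f : List DyckStep → ℕ) (w : List DyckStep) :
    (List.range (w.count DyckStep.U + 1)).map (fun i => f (afterUp i w)) =
      f w :: mapAfterUps f w := by
  rw [List.range_succ_eq_map, List.map_cons, List.map_map, afterUp_zero]
  congr 1
  induction w with
  | nil => rfl
  | cons x w ih =>
    cases x
    · rw [List.count_cons_self, List.range_succ_eq_map, List.map_cons, List.map_map]
      rw [mapAfterUps, ← ih]
      exact congrArg (f · :: _) (afterUp_zero w)
    · rw [List.count_cons_of_ne (by simp)]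
      exact ih

theorem downRun_append {s v : List DyckStep} (hv : downRun v = 0) :
    downRun (s ++ v) = downRun s := by
  induction s with
  | nil => exact hv
  | cons x s ih =>
    cases x
    · rfl
    · simp only [downRun] at ih
      simp [downRun, ih]

theorem downRun_append_of_mem {s : List DyckStep} (h : DyckStep.U ∈ s) (v : List DyckStep) :
    downRun (s ++ v) = downRun s := by
  induction s with
  | nil => simp at h
  | cons x s ih =>
    cases x
    · rfl
    · have := ih (by simpa using h)
      simp only [downRun] at this
      simp [downRun, this]

theorem DyckWord.downRun_eq_zero (p : DyckWord) : downRun p.toList = 0 := by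
  induction p using DyckWord.nest_add_induction <;> rfl

theorem eq_replicate_D_of_notMem {w : List DyckStep} (h : DyckStep.U ∉ w) :
    w = List.replicate w.length DyckStep.D :=
  List.eq_replicate_of_mem fun x hx => by
    cases x
    · exact absurd hx h
    · rfl

theorem mapAfterUps_replicate_D (f : List DyckStep → ℕ) (n : ℕ) :
    mapAfterUps f (List.replicate n DyckStep.D) = [] := by
  induction n with
  | zero => rfl
  | succ n ih => exact ih

/-- Appending a down step changes only the last run of down steps. -/
theorem mapAfterUps_downRun_append_D {w : List DyckStep} (h : DyckStep.U ∈ w) :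
    ∃ l r, mapAfterUps downRun w = l ++ [r] ∧
      mapAfterUps downRun (w ++ [DyckStep.D]) = l ++ [r + 1] ∧
      (w.getLast? = some DyckStep.D → 1 ≤ r) := by
  induction w with
  | nil => simp at h
  | cons x w ih =>
    by_cases hw : DyckStep.U ∈ w
    · obtain ⟨l, r, h₁, h₂, h₃⟩ := ih hw
      have hne : w ≠ [] := List.ne_nil_of_mem hw
      have hr : (x :: w).getLast? = some DyckStep.D → 1 ≤ r := fun h' =>
        h₃ (by rwa [List.getLast?_cons_of_ne_nil hne] at h')
      cases x
      · refine ⟨downRun w :: l, r, ?_, ?_, hr⟩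
        · simp [mapAfterUps, h₁]
        · simp [mapAfterUps, h₂, downRun_append_of_mem hw]
      · exact ⟨l, r, h₁, h₂, hr⟩
    · obtain rfl : DyckStep.U = x := by simpa [hw] using h
      rw [eq_replicate_D_of_notMem hw, List.cons_append, ← List.replicate_succ']
      refine ⟨[], w.length, ?_, ?_, ?_⟩
      · simp [mapAfterUps, mapAfterUps_replicate_D, downRun]
      · rw [mapAfterUps, mapAfterUps_replicate_D]
        simp [downRun]
      · rcases w with _ | ⟨y, w⟩ <;> simp

theorem mapAfterUps_returnCount_eq_append_zero {w : List DyckStep} (h : DyckStep.U ∈ w) :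
    ∃ l, mapAfterUps (returnCount 0) w = l ++ [0] := by
  induction w with
  | nil => simp at h
  | cons x w ih =>
    by_cases hw : DyckStep.U ∈ w
    · obtain ⟨l, hl⟩ := ih hw
      cases x
      · exact ⟨returnCount 0 w :: l, by simp [mapAfterUps, hl]⟩
      · exact ⟨l, hl⟩
    · obtain rfl : DyckStep.U = x := by simpa [hw] using h
      rw [eq_replicate_D_of_notMem hw, mapAfterUps, mapAfterUps_replicate_D]
      exact ⟨[], by cases w.length <;> rfl⟩

/-- Once the walk has gone below height `0`, the rest of the word does not matter. -/
theorem returnCount_append_of_lt {h : ℕ} {w : List DyckStep}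
    (hw : h + w.count DyckStep.U < w.count DyckStep.D) (v : List DyckStep) :
    returnCount h (w ++ v) = returnCount h w := by
  induction w generalizing h with
  | nil => simp at hw
  | cons x w ih =>
    cases x
    · exact ih (h := h + 1) (by simp at hw; omega)
    · rcases h with _ | _ | h
      · rfl
      · exact congrArg (· + 1) (ih (h := 0) (by simp at hw; omega))
      · exact ih (h := h + 1) (by simp at hw; omega)

namespace DyckWord

theorem mapAfterUps_returnCount_append (p : DyckWord) (v : List DyckStep) :
    mapAfterUps (returnCount 0) (p.toList ++ v) =
      mapAfterUps (returnCount 0) p.toList ++ mapAfterUps (returnCount 0) v := by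
  refine mapAfterUps_append fun s hs => returnCount_append_of_lt ?_ v
  have := p.count_U_le_count_D_of_suffix hs
  simp at this
  omega

theorem returnCount_succ_append (p : DyckWord) (h : ℕ) (v : List DyckStep) :
    returnCount (h + 1) (p.toList ++ v) = returnCount (h + 1) v := by
  induction p using DyckWord.nest_add_induction generalizing h v with
  | zero => rfl
  | nest_add q r hq hr =>
    simp only [toList_add, toList_nest, List.cons_append, List.append_assoc, List.nil_append]
    rw [returnCount, hq, returnCount, hr]

theorem returnCount_zero_append (p : DyckWord) (v : List DyckStep) :
    returnCount 0 (p.toList ++ v) = returnCount 0 p.toList + returnCount 0 v := by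
  induction p using DyckWord.nest_add_induction generalizing v with
  | zero => simp [toList_zero, returnCount]
  | nest_add q r _ hr =>
    simp only [toList_add, toList_nest, List.cons_append, List.append_assoc, List.nil_append]
    rw [returnCount, returnCount, returnCount_succ_append, returnCount_succ_append, returnCount,
      returnCount, hr]
    omega

theorem U_mem_toList {p : DyckWord} (hp : p ≠ 0) : DyckStep.U ∈ p.toList :=
  p.head_eq_U (toList_ne_nil.mpr hp) ▸ List.head_mem _

theorem semilength_eq_zero {p : DyckWord} : p.semilength = 0 ↔ p = 0 := by
  refine ⟨fun h => ?_, fun h => h ▸ rfl⟩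
  by_contra hp
  exact absurd h (List.count_pos_iff.mpr (U_mem_toList hp)).ne'

/-- The contacts `c₁, …, c_n` of a Dyck path. -/
def contacts (p : DyckWord) : List ℕ := mapAfterUps (returnCount 0) p.toList

/-- The descents `d_{n-1}, …, d₀` of a Dyck path, that is, the lengths of the runs of down steps
after each up step, from left to right. -/
def descents (p : DyckWord) : List ℕ := mapAfterUps downRun p.toList

theorem length_contacts (p : DyckWord) : p.contacts.length = p.semilength :=
  length_mapAfterUps _ _

theorem length_descents (p : DyckWord) : p.descents.length = p.semilength :=
  length_mapAfterUps _ _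

theorem contactVector_zero (p : DyckWord) : contactVector p 0 = returnCount 0 p.toList := by
  rw [contactVector, afterUp_zero]

theorem contactVector_zero_add (p q : DyckWord) :
    contactVector (p + q) 0 = contactVector p 0 + contactVector q 0 := by
  simp only [contactVector_zero, toList_add, returnCount_zero_append]

theorem contactVector_zero_nest (p : DyckWord) : contactVector p.nest 0 = 1 := by
  rw [contactVector_zero, toList_nest, returnCount, returnCount_succ_append]
  rfl

theorem one_le_contactVector_zero {p : DyckWord} (hp : p ≠ 0) : 1 ≤ contactVector p 0 := by
  rw [← nest_insidePart_add_outsidePart hp, contactVector_zero_add, contactVector_zero_nest]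
  omega

theorem contacts_add (p q : DyckWord) : (p + q).contacts = p.contacts ++ q.contacts :=
  p.mapAfterUps_returnCount_append q.toList

theorem contacts_nest (p : DyckWord) : p.nest.contacts = contactVector p 0 :: p.contacts := by
  have : returnCount 0 (p.toList ++ [DyckStep.D]) = contactVector p 0 :=
    (p.returnCount_zero_append _).trans p.contactVector_zero.symm
  rw [contacts, toList_nest, mapAfterUps, this, mapAfterUps_returnCount_append]
  exact congrArg _ (List.append_nil _)

theorem descents_add (p q : DyckWord) : (p + q).descents = p.descents ++ q.descents :=
  mapAfterUps_append fun _ _ => downRun_append q.downRun_eq_zero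

theorem descents_nest_zero : (0 : DyckWord).nest.descents = [1] := rfl

theorem descents_nest {p : DyckWord} (hp : p ≠ 0) :
    ∃ l r, p.descents = l ++ [r + 1] ∧ p.nest.descents = 0 :: (l ++ [r + 2]) := by
  obtain ⟨l, r, h₁, h₂, h₃⟩ := mapAfterUps_downRun_append_D (U_mem_toList hp)
  have hr := h₃ (by
    rw [List.getLast?_eq_some_getLast (toList_ne_nil.mpr hp), getLast_eq_D])
  obtain ⟨r, rfl⟩ := Nat.exists_eq_add_of_le' hr
  refine ⟨l, r, h₁, ?_⟩
  rw [descents, toList_nest, mapAfterUps, h₂, downRun_append_of_mem (U_mem_toList hp),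
    downRun_eq_zero]

theorem contacts_eq_append_zero {p : DyckWord} (hp : p ≠ 0) : ∃ l, p.contacts = l ++ [0] :=
  mapAfterUps_returnCount_eq_append_zero (U_mem_toList hp)

theorem map_range_contactVector (p : DyckWord) :
    (List.range (p.semilength + 1)).map (contactVector p) = contactVector p 0 :: p.contacts := by
  rw [contactVector_zero]
  exact map_range_afterUp (returnCount 0) p.toList

theorem map_range_descentVector (p : DyckWord) :
    (List.range (p.semilength + 1)).map (fun i => descentVector p (p.semilength - i)) =
      0 :: p.descents := by
  have := map_range_afterUp downRun p.toList
  rw [p.downRun_eq_zero] at this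
  refine Eq.trans (List.map_congr_left fun i hi => ?_) this
  rw [List.mem_range] at hi
  rw [descentVector, Nat.sub_sub_self (by omega)]
  rfl

end DyckWord

/-! ### The explicit word under left composition -/

open FishStep in
/-- The block of the explicit word that belongs to a contact `c` and a descent `d`. -/
def block (c d : ℕ) : List FishStep :=
  if 1 ≤ c then List.replicate (c - 1) E ++ [N]
  else if 1 ≤ d then [W] ++ List.replicate (d - 1) S
  else [V]

/-- The concatenation of the blocks that belong to a list of contacts and a list of descents. -/
def blocks (cs ds : List ℕ) : List FishStep := (List.zipWith block cs ds).flatten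

theorem blocks_cons (c d : ℕ) (cs ds : List ℕ) :
    blocks (c :: cs) (d :: ds) = block c d ++ blocks cs ds := rfl

theorem blocks_append {cs ds : List ℕ} (h : cs.length = ds.length) (cs' ds' : List ℕ) :
    blocks (cs ++ cs') (ds ++ ds') = blocks cs ds ++ blocks cs' ds' := by
  rw [blocks, List.zipWith_append h, List.flatten_append]
  rfl

theorem block_of_one_le {c : ℕ} (h : 1 ≤ c) (d : ℕ) : block c d = fishShape (c - 1) [] := if_pos h

theorem cons_block {c : ℕ} (h : 1 ≤ c) (d : ℕ) (G : List FishStep) :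
    FishStep.E :: (block c d ++ G) = fishShape c G := by
  obtain ⟨c, rfl⟩ := Nat.exists_eq_add_of_le' h
  rw [block_of_one_le h, fishShape_append]
  rfl

theorem flatMap_range_block (n : ℕ) (f g : ℕ → ℕ) :
    (List.range n).flatMap (fun i => block (f i) (g i)) =
      blocks ((List.range n).map f) ((List.range n).map g) := by
  simp [blocks, List.flatMap, List.zipWith_map, List.zipWith_self]

/-- The part of the explicit word that follows the block `w₀`, without the final `S`. -/
def TamariInterval.tailBlocks (I : TamariInterval) : List FishStep :=
  blocks I.lower.contacts I.upper.descents

namespace TamariInterval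

theorem length_contacts_eq (I : TamariInterval) :
    I.lower.contacts.length = I.upper.descents.length := by
  rw [DyckWord.length_contacts, DyckWord.length_descents, I.le.semilength_eq]

theorem upper_eq_zero_iff (I : TamariInterval) : I.upper = 0 ↔ I.lower = 0 := by
  rw [← DyckWord.semilength_eq_zero, ← DyckWord.semilength_eq_zero, I.le.semilength_eq]

theorem map_range_descent (I : TamariInterval) :
    (List.range (I.size + 1)).map (fun i => I.descent (I.size - i)) = 0 :: I.upper.descents := by
  rw [size, I.le.semilength_eq]
  exact I.upper.map_range_descentVector

theorem explicitWord_eq (I : TamariInterval) :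
    explicitWord I = FishStep.E :: (block (contactVector I.lower 0) 0 ++
      (I.tailBlocks ++ [FishStep.S])) := by
  have h : (List.range (I.size + 1)).flatMap (blockWord I) = _ :=
    flatMap_range_block (I.size + 1) I.contact fun i => I.descent (I.size - i)
  have hc : (List.range (I.size + 1)).map I.contact = _ := I.lower.map_range_contactVector
  rw [explicitWord, h, hc, map_range_descent, blocks_cons, tailBlocks]
  simp

theorem explicitWord_of_lower_eq_zero {I : TamariInterval} (h : I.lower = 0) :
    explicitWord I = emptyFishWord := by
  rw [explicitWord_eq, tailBlocks, h, I.upper_eq_zero_iff.mpr h]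
  rfl

theorem explicitWord_of_lower_ne_zero {I : TamariInterval} (h : I.lower ≠ 0) :
    explicitWord I = fishShape (contactVector I.lower 0) (I.tailBlocks ++ [FishStep.S]) := by
  rw [explicitWord_eq, cons_block (DyckWord.one_le_contactVector_zero h)]

theorem jaw_explicitWord (I : TamariInterval) :
    jaw (explicitWord I) = contactVector I.lower 0 := by
  by_cases h : I.lower = 0
  · rw [explicitWord_of_lower_eq_zero h, h]
    rfl
  · rw [explicitWord_of_lower_ne_zero h, jaw_fishShape]

theorem explicitWord_concat (I₁ I₂ : TamariInterval) :
    explicitWord (I₁.concat I₂) = fishConcat (explicitWord I₁) (explicitWord I₂) := by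
  by_cases h₁ : I₁.lower = 0
  · rw [explicitWord_of_lower_eq_zero h₁, fishConcat_empty_left]
    congr 1
    simp [concat, h₁, I₁.upper_eq_zero_iff.mpr h₁]
  by_cases h₂ : I₂.lower = 0
  · rw [explicitWord_of_lower_eq_zero h₂, fishConcat_empty_right]
    congr 1
    simp [concat, h₂, I₂.upper_eq_zero_iff.mpr h₂]
  rw [explicitWord_of_lower_ne_zero h₁, explicitWord_of_lower_ne_zero h₂, fishConcat_fishShape,
    explicitWord_of_lower_ne_zero (by simp [concat, h₁])]
  simp only [concat, tailBlocks, DyckWord.contactVector_zero_add, DyckWord.contacts_add,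
    DyckWord.descents_add, blocks_append I₁.length_contacts_eq, List.append_assoc]
  rw [add_comm]

end TamariInterval

namespace PointedTamariInterval

open FishStep

theorem index_le_jaw (J : PointedTamariInterval) :
    J.index ≤ jaw (explicitWord J.toInterval) + 1 := by
  rw [TamariInterval.jaw_explicitWord, index, toInterval, DyckWord.contactVector_zero_add]
  omega

/-- Nesting the upper path lengthens the last run of down steps by one; the last contact of
the lower path is `0`, so this appends the letter `S` to the last block `W S^(d-1)`. -/
theorem tailBlocks_augment (J : PointedTamariInterval) (h : J.toInterval.lower ≠ 0) :
    J.augment.tailBlocks =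
      block (contactVector J.left 0) 0 ++ (J.toInterval.tailBlocks ++ [S]) := by
  obtain ⟨cs, hc⟩ := DyckWord.contacts_eq_append_zero h
  obtain ⟨ds, r, hd, hd'⟩ := DyckWord.descents_nest (mt J.toInterval.upper_eq_zero_iff.mp h)
  have hlen := J.toInterval.length_contacts_eq
  rw [hc, hd, List.length_append, List.length_append, List.length_singleton,
    List.length_singleton, Nat.add_right_cancel_iff] at hlen
  have hc' : J.augment.lower.contacts = contactVector J.left 0 :: (cs ++ [0]) := by
    rw [← hc]
    simp only [augment, toInterval, DyckWord.contacts_add, DyckWord.contacts_nest,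
      List.cons_append]
  have hd'' : J.augment.upper.descents = 0 :: (ds ++ [r + 2]) := hd'
  rw [TamariInterval.tailBlocks, TamariInterval.tailBlocks, hc, hd, hc', hd'', blocks_cons,
    blocks_append hlen, blocks_append hlen]
  simp [blocks, block, List.replicate_succ']

theorem explicitWord_augment (J : PointedTamariInterval) :
    explicitWord J.augment = fishAugment J.index (explicitWord J.toInterval) := by
  have hne : J.augment.lower ≠ 0 := DyckWord.nest_add_ne_zero _ _
  have hi : contactVector J.augment.lower 0 = J.index := by
    simp only [augment, index, DyckWord.contactVector_zero_add, DyckWord.contactVector_zero_nest]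
    omega
  by_cases h : J.toInterval.lower = 0
  · have hQ : J.upper = 0 := J.toInterval.upper_eq_zero_iff.mpr h
    obtain ⟨hl, hr⟩ : J.left = 0 ∧ J.right = 0 := add_eq_zero'.mp h
    rw [TamariInterval.explicitWord_of_lower_eq_zero h,
      TamariInterval.explicitWord_of_lower_ne_zero hne, hi, fishAugment, if_pos rfl]
    simp only [index, TamariInterval.tailBlocks, augment, hl, hr, hQ]
    rfl
  · rw [TamariInterval.explicitWord_of_lower_ne_zero hne, hi, tailBlocks_augment J h,
      TamariInterval.explicitWord_of_lower_ne_zero h]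
    have hj : contactVector J.toInterval.lower 0 + 1 = contactVector J.left 0 + J.index := by
      simp only [toInterval, index, DyckWord.contactVector_zero_add, add_assoc]
    rcases Nat.eq_zero_or_pos (contactVector J.left 0) with h0 | hpos
    · rw [h0, show J.index = contactVector J.toInterval.lower 0 + 1 by omega,
        fishAugment_fishShape_succ]
      simp [block]
    · rw [fishAugment_fishShape_of_le (by omega), block_of_one_le hpos, fishShape_append]
      rw [show contactVector J.toInterval.lower 0 - J.index = contactVector J.left 0 - 1 by omega]
      simp [fishShape]

theorem explicitWord_leftComposition (J : PointedTamariInterval) (I : TamariInterval) :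
    explicitWord (J.leftComposition I) =
      lowComposition J.index (explicitWord J.toInterval) (explicitWord I) := by
  rw [leftComposition, TamariInterval.explicitWord_concat, explicitWord_augment, lowComposition]

/-- Augmentation keeps the property that each contact or the matching descent vanishes: the two
lists both gain an entry, and the only descent that grows is the last one, whose contact is `0`. -/
theorem contacts_descents_augment (J : PointedTamariInterval)
    (h : List.Forall₂ (fun c d => c = 0 ∨ d = 0) J.toInterval.lower.contacts
      J.toInterval.upper.descents) :
    List.Forall₂ (fun c d => c = 0 ∨ d = 0) J.augment.lower.contacts
      J.augment.upper.descents := by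
  have hc : J.augment.lower.contacts =
      contactVector J.left 0 :: J.toInterval.lower.contacts := by
    simp only [augment, toInterval, DyckWord.contacts_add, DyckWord.contacts_nest,
      List.cons_append]
  rw [hc]
  by_cases h0 : J.toInterval.lower = 0
  · have hQ : J.upper = 0 := J.toInterval.upper_eq_zero_iff.mpr h0
    obtain ⟨hl, hr⟩ : J.left = 0 ∧ J.right = 0 := add_eq_zero'.mp h0
    have hd : J.augment.upper.descents = [1] := by
      simp only [augment, hQ, DyckWord.descents_nest_zero]
    rw [hd, h0, hl]
    exact .cons (Or.inl rfl) .nil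
  · obtain ⟨cs, hcs⟩ := DyckWord.contacts_eq_append_zero h0
    obtain ⟨ds, r, hd, hd'⟩ := DyckWord.descents_nest (mt J.toInterval.upper_eq_zero_iff.mp h0)
    have hd'' : J.augment.upper.descents = 0 :: (ds ++ [r + 2]) := hd'
    rw [hcs, hd] at h
    rw [hd'', hcs]
    refine .cons (Or.inr rfl) (List.rel_append ?_ (.cons (Or.inl rfl) .nil))
    have hlen := h.length_eq
    simp only [List.length_append, List.length_singleton, Nat.add_right_cancel_iff] at hlen
    have := List.forall₂_take cs.length h
    rwa [List.take_left, hlen, List.take_left] at this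

end PointedTamariInterval

namespace TamariInterval

theorem contacts_descents (I : TamariInterval) :
    List.Forall₂ (fun c d => c = 0 ∨ d = 0) I.lower.contacts I.upper.descents := by
  induction I using composition_induction with
  | empty => exact .nil
  | comp J I hJ hI =>
    simp only [PointedTamariInterval.leftComposition, concat, DyckWord.contacts_add,
      DyckWord.descents_add]
    exact List.rel_append (J.contacts_descents_augment hJ) hI

theorem isExtendedFightingFish_explicitWord (I : TamariInterval) :
    IsExtendedFightingFish (explicitWord I) := by
  induction I using composition_induction with
  | empty => exact Or.inl (explicitWord_of_lower_eq_zero rfl)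
  | comp J I hJ hI =>
    rw [J.explicitWord_leftComposition]
    exact hJ.lowComposition hI (Nat.le_add_left _ _) J.index_le_jaw

end TamariInterval

/-! ### The map `Φ` -/

theorem SatisfiesPhiRecursion.word_eq {Φ : TamariInterval → ExtendedFightingFish}
    (h : SatisfiesPhiRecursion Φ) (I : TamariInterval) : (Φ I).word = explicitWord I := by
  induction I using TamariInterval.composition_induction with
  | empty =>
    rw [h.1]
    exact (TamariInterval.explicitWord_of_lower_eq_zero rfl).symm
  | comp J I hJ hI => rw [(h.2 J I).2, hJ, hI, J.explicitWord_leftComposition]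

theorem satisfiesPhiRecursion_explicitWord :
    SatisfiesPhiRecursion fun I => ⟨explicitWord I, I.isExtendedFightingFish_explicitWord⟩ := by
  refine ⟨?_, fun J I => ⟨J.index_le_jaw, J.explicitWord_leftComposition I⟩⟩
  exact (ExtendedFightingFish.mk.injEq _ _ _ _).mpr
    (TamariInterval.explicitWord_of_lower_eq_zero rfl)

theorem mainTheorem3 :
    (∀ I : TamariInterval, ∀ i ≤ I.size, I.contact i = 0 ∨ I.descent (I.size - i) = 0) ∧
    (∃! Φ : TamariInterval → ExtendedFightingFish, SatisfiesPhiRecursion Φ) ∧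
    (∀ Φ : TamariInterval → ExtendedFightingFish, SatisfiesPhiRecursion Φ →
      ∀ I : TamariInterval, (Φ I).word = explicitWord I) := by
  refine ⟨fun I i hi => ?_, ⟨_, satisfiesPhiRecursion_explicitWord, fun Φ hΦ => ?_⟩,
    fun Φ hΦ => hΦ.word_eq⟩
  · have hc : (List.range (I.size + 1)).map I.contact = _ := I.lower.map_range_contactVector
    have h : List.Forall₂ (fun c d => c = 0 ∨ d = 0) ((List.range (I.size + 1)).map I.contact)
        ((List.range (I.size + 1)).map fun i => I.descent (I.size - i)) := by
      rw [hc, I.map_range_descent]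
      exact .cons (Or.inr rfl) I.contacts_descents
    rw [List.forall₂_map_left_iff, List.forall₂_map_right_iff, List.forall₂_same] at h
    exact h i (List.mem_range.mpr (by omega))
  · funext I
    have h := hΦ.word_eq I
    cases hF : Φ I
    simp_all
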